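/- **Conventions.** $B(a,r)$ is the closed ball in $\mathbb R^3$, $\mathcal H^2$ the two-dimensional Hausdorff measure (normalised to agree with Lebesgue measure on planes), and for a unit vector $w$ put $C^{\pm}(\varphi,w)=\{y\in\mathbb R^3:\pm\, y\cdot w\ge |y|\cos\varphi\}$. *Admissible surfaces.* A compact connected set $\Sigma\subset\mathbb R^3$ with $\Sigma=\partial U$ for a bounded domain $U$ is admissible if (a) there is $K>0$ with $\infty>\mathcal H^2(\Sigma\cap B(x,r))\ge K^{-1}r^2$ for all $x\in\Sigma$ and $0<r\le\operatorname{diam}\Sigma$; and (b) there is a dense subset $\Sigma^*\subset\Sigma$ such that for each $x\in\Sigma^*$ there are a unit vector $v(x)$ and a radius $\delta_0(x)>0$ with $B(x,\delta_0(x))\cap(x+C^+(\pi/4,v(x)))\subset U\cup\{x\}$ and $B(x,\delta_0(x))\cap(x+C^-(\pi/4,v(x)))\subset(\mathbb R^3\setminus\overline U)\cup\{x\}$. *Energy.* For $T=(x_0,x_1,x_2,x_3)\in(\mathbb R^3)^4$ let $\mathcal K(T)=\dfrac{V(T)}{A(T)(\operatorname{diam}T)^2}$ if the vertices are not coplanar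 and $\mathcal K(T)=0$ otherwise, where $V$ is the volume and $A$ the total area of the four faces; $\mathscr M_p(\Sigma)=\int_{\Sigma^4}\mathcal K^p\,d(\mathcal H^2)^{\otimes 4}\in[0,\infty]$. *Voluminous tetrahedra.* $T\in\mathscr V(\theta,d)$ means: $x_i\in B(x_0,2d)$ for $i=1,2,3$; $|x_i-x_j|\ge\theta d$ for $i\ne j$; $\angle(x_1-x_0,x_2-x_0)\in[\theta,\pi-\theta]$; and the distance of $x_3$ to the affine span of $\{x_0,x_1,x_2\}$ is at least $\theta d$. Put $\|T-T'\|=\min_{\sigma\in S_4}\max_i|x_i-x'_{\sigma(i)}|$. *Stopping distances.* Let constants $\alpha,\eta$ and an admissible $\Sigma$ be given, with $U,\Sigma^*,v,\delta_0$ as above, and let $x_0\in\Sigma^*$. A stopping distance at $x_0$ is a number $d\in(\delta_0(x_0),\operatorname{diam}\Sigma]$ such that - there are $x_1,x_2,x_3\in\Sigma$ such that $T=(x_0,x_1,x_2,x_3)\in\mathscr V(\eta,d)$ and $T'\in\mathscr V(\frac\eta2,\frac32d)$ whenever $\|T'-T\|\le\alpha d$; - for each $r\in(0,d]$ there is an affine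 plane $H$ through $x_0$ with $\pi_H(\Sigma\cap B(x_0,r))\supset H\cap B(x_0,r/\sqrt2)$, where $\pi_H$ is the orthogonal projection onto $H$; - $\mathcal H^2(\Sigma\cap B(x_0,r))\ge\frac\pi2r^2$ for each $r\in(0,d]$. **Proposition 3.5.** There are absolute constants $\alpha,\eta$ with $1>2\eta>40\alpha>0$ such that the following holds for every admissible surface $\Sigma$ and every choice of $U,\Sigma^*,v,\delta_0$ as in the definition of admissibility. Every $x_0\in\Sigma^*$ has a stopping distance. Moreover, for every choice $x_0\mapsto d_s(x_0)$ of a stopping distance at each $x_0\in\Sigma^*$ and every $p>8$ with $\mathscr M_p(\Sigma)<\infty$: 1. $d(\Sigma):=\inf_{x_0\in\Sigma^*}d_s(x_0)>0$; 2. $\mathscr M_p(\Sigma)\ge\alpha^{5p}\,d(\Sigma)^{8-p}$. Consequently $\mathscr M_p(\Sigma)>0$ and $$\left(\frac{\alpha^{5p}}{\mathscr M_p(\Sigma)}\right)^{\frac1{p-8}}\le d(\Sigma)\le\operatorname{diam}\Sigma .$$ -/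

import Mathlib

open MeasureTheory
open scoped ENNReal

namespace IntegralMenger

/-- Euclidean three-space. -/
abbrev E3 : Type := EuclideanSpace ℝ (Fin 3)

/-- The two-dimensional Hausdorff measure on `ℝ³`, normalised so that it agrees with the
Lebesgue measure on planes. -/
noncomputable def H2 : Measure E3 := μHE[2]

/-- The cross product on `ℝ³`. -/
noncomputable def cross (a b : E3) : E3 :=
  WithLp.toLp 2 (crossProduct (WithLp.ofLp a) (WithLp.ofLp b))

/-! ### Admissible surfaces -/

/-- The conical half `{y : y · w ≥ |y| cos φ}` with vertex `0`; the opposite half is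
`coneHalf φ (-w)`. -/
def coneHalf (φ : ℝ) (w : E3) : Set E3 :=
  {y | ‖y‖ * Real.cos φ ≤ inner ℝ y w}

/-- `S` is an admissible surface, as witnessed by the bounded domain `U` which it bounds, the dense
subset `Sstar` of `S`, the axes `v x` and the radii `δ₀ x` (used for `x ∈ Sstar` only). -/
structure IsAdmissibleSurface (S U Sstar : Set E3) (v : E3 → E3) (δ₀ : E3 → ℝ) : Prop where
  isCompact : IsCompact S
  isConnected : IsConnected S
  isOpen_domain : IsOpen U
  isConnected_domain : IsConnected U
  isBounded_domain : Bornology.IsBounded U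
  eq_frontier : S = frontier U
  /-- Finite area, and a (non-uniform) lower area bound at all scales. -/
  area_bound : ∃ K : ℝ, 0 < K ∧ ∀ x ∈ S, ∀ r : ℝ, 0 < r → r ≤ Metric.diam S →
    H2 (S ∩ Metric.closedBall x r) < ⊤ ∧
      ENNReal.ofReal (K⁻¹ * r ^ 2) ≤ H2 (S ∩ Metric.closedBall x r)
  subset : Sstar ⊆ S
  dense : S ⊆ closure Sstar
  norm_axis : ∀ x ∈ Sstar, ‖v x‖ = 1
  radius_pos : ∀ x ∈ Sstar, 0 < δ₀ x
  cone_inside : ∀ x ∈ Sstar, ∀ y ∈ Metric.closedBall x (δ₀ x),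
    y - x ∈ coneHalf (Real.pi / 4) (v x) → y ∈ U ∪ {x}
  cone_outside : ∀ x ∈ Sstar, ∀ y ∈ Metric.closedBall x (δ₀ x),
    y - x ∈ coneHalf (Real.pi / 4) (-v x) → y ∈ (closure U)ᶜ ∪ {x}

/-! ### Tetrahedra and the energy -/

/-- The area of the triangle with vertices `a`, `b`, `c`. -/
noncomputable def triangleArea (a b c : E3) : ℝ := ‖cross (b - a) (c - a)‖ / 2

/-- The volume of the tetrahedron with vertices `T 0`, `T 1`, `T 2`, `T 3`. -/
noncomputable def tetVolume (T : Fin 4 → E3) : ℝ :=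
  |inner ℝ (T 3 - T 0) (cross (T 1 - T 0) (T 2 - T 0))| / 6

/-- The total area of the four faces of a tetrahedron. -/
noncomputable def tetArea (T : Fin 4 → E3) : ℝ :=
  triangleArea (T 0) (T 1) (T 2) + triangleArea (T 0) (T 2) (T 3) +
    triangleArea (T 0) (T 1) (T 3) + triangleArea (T 1) (T 2) (T 3)

open Classical in
/-- The curvature integrand `V(T) / (A(T) (diam T)²)`, set to `0` on coplanar quadruples. -/
noncomputable def curvature (T : Fin 4 → E3) : ℝ :=
  if Coplanar ℝ (Set.range T) then 0
  else tetVolume T / (tetArea T * Metric.diam (Set.range T) ^ 2)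

/-- The integral Menger curvature of `S` with exponent `p`. -/
noncomputable def mengerEnergy (p : ℝ) (S : Set E3) : ℝ≥0∞ :=
  ∫⁻ x₀ in S, ∫⁻ x₁ in S, ∫⁻ x₂ in S, ∫⁻ x₃ in S,
    ENNReal.ofReal (curvature ![x₀, x₁, x₂, x₃] ^ p) ∂H2 ∂H2 ∂H2 ∂H2

/-- The distance of two tetrahedra: the maximal distance of corresponding vertices, minimised over
all pairings of the vertices. -/
noncomputable def tetDist (T T' : Fin 4 → E3) : ℝ :=
  ⨅ σ : Equiv.Perm (Fin 4), ⨆ i : Fin 4, ‖T i - T' (σ i)‖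

/-- `T` is `(θ, d)`-voluminous. -/
structure IsVoluminous (θ d : ℝ) (T : Fin 4 → E3) : Prop where
  mem_ball : ∀ i, T i ∈ Metric.closedBall (T 0) (2 * d)
  separated : ∀ i j, i ≠ j → θ * d ≤ ‖T i - T j‖
  angle_mem : InnerProductGeometry.angle (T 1 - T 0) (T 2 - T 0) ∈ Set.Icc θ (Real.pi - θ)
  height : θ * d ≤ Metric.infDist (T 3) (affineSpan ℝ {T 0, T 1, T 2} : Set E3)

/-! ### Stopping distances -/

/-- `d` is a stopping distance of the surface `S` at the point `x₀`, with respect to the constants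
`α`, `η` and the cone radius `δ` of `S` at `x₀`. -/
structure IsStoppingDistance (α η : ℝ) (S : Set E3) (δ : ℝ) (x₀ : E3) (d : ℝ) : Prop where
  radius_lt : δ < d
  le_diam : d ≤ Metric.diam S
  /-- A voluminous tetrahedron with one vertex at `x₀` and the others on `S`, all of whose small
  perturbations are voluminous. -/
  good_tetrahedron : ∃ x₁ ∈ S, ∃ x₂ ∈ S, ∃ x₃ ∈ S,
    IsVoluminous η d ![x₀, x₁, x₂, x₃] ∧
    ∀ T' : Fin 4 → E3, tetDist T' ![x₀, x₁, x₂, x₃] ≤ α * d →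
      IsVoluminous (η / 2) (3 / 2 * d) T'
  /-- At all scales up to `d`, the surface has a large orthogonal projection onto some affine plane
  through `x₀`, whose direction is `W`. -/
  large_projection : ∀ r : ℝ, 0 < r → r ≤ d → ∃ W : Submodule ℝ E3, Module.finrank ℝ W = 2 ∧
    (AffineSubspace.mk' x₀ W : Set E3) ∩ Metric.closedBall x₀ (r / √2) ⊆
      (fun y : E3 => (EuclideanGeometry.orthogonalProjection (AffineSubspace.mk' x₀ W) y : E3)) ''
        (S ∩ Metric.closedBall x₀ r)
  lower_area : ∀ r : ℝ, 0 < r → r ≤ d →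
    ENNReal.ofReal (Real.pi / 2 * r ^ 2) ≤ H2 (S ∩ Metric.closedBall x₀ r)

end IntegralMenger

namespace IntegralMenger

/-! ### The triple product -/

/-! Existence. Say that a sphere of radius `r` about `x₀` has caps if, for some axis `w`, one closed
cap of opening angle π/4 lies in `closure U` and the opposite one misses `U` (`HasCaps`). Small
spheres have caps by the cone condition, and `d` is the largest radius up to which all spheres do.
For `r ≤ d` every segment parallel to `w` joining opposite caps meets the surface, so the projection
along `w` covers a disc of radius `r / √2`; projections do not increase area, whence the bound `π r²
/ 2`. Two such crossings in orthogonal directions give surface points `x₀ + a`, `x₀ + b` with `|w ·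
(a × b)| = d² / 2`. If the surface within `7d/5` stayed in the slab `|x · (a × b)| < d³ / 8`, the
parts of that ball on either side of the slab would lie one in `U`, one outside, and caps with axis
`± a × b` would persist beyond `d`, against maximality (`HasCaps.exists_forall_hasCaps`). So some
surface point leaves the slab, giving a tetrahedron with determinant at least `d³ / 8`; this alone
makes it and its perturbations voluminous (`isVoluminous_of_fat`).

Energy. Voluminous tetrahedra have curvature at least a constant over `d`. Integrating over four
balls of radius `α d` about the vertices, each of area at least `β d²`, gives energy at least `c β⁴
d ^ (8 - p)` (`mengerEnergy_ge_of_tetrahedron`). This is used twice. With `β` from the non-uniform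
constant `K` it shows that stopping distances are bounded away from zero, as `p > 8`. Once their
infimum `m` is positive, the area bound at nearby points of `Sstar` gives an absolute `β`, and a
stopping distance below `2 m` yields the uniform estimate. -/

lemma inner_eq_coords (x y : E3) : inner ℝ x y = x 0 * y 0 + x 1 * y 1 + x 2 * y 2 := by
  simp only [PiLp.inner_apply, RCLike.inner_apply, conj_trivial, Fin.sum_univ_three]
  ring

@[simp] lemma cross_zero_apply (a b : E3) : cross a b 0 = a 1 * b 2 - a 2 * b 1 := by
  simp [cross, cross_apply]

@[simp] lemma cross_one_apply (a b : E3) : cross a b 1 = a 2 * b 0 - a 0 * b 2 := by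
  simp [cross, cross_apply]

@[simp] lemma cross_two_apply (a b : E3) : cross a b 2 = a 0 * b 1 - a 1 * b 0 := by
  simp [cross, cross_apply]

lemma norm_cross (a b : E3) :
    ‖cross a b‖ = ‖a‖ * ‖b‖ * Real.sin (InnerProductGeometry.angle a b) :=
  InnerProductGeometry.norm_ofLp_crossProduct a b

lemma norm_cross_le (a b : E3) : ‖cross a b‖ ≤ ‖a‖ * ‖b‖ := by
  rw [norm_cross]
  exact mul_le_of_le_one_right (by positivity) (Real.sin_le_one _)

/-- The triple product `(a × b) · c`. -/
noncomputable def triple (a b c : E3) : ℝ := inner ℝ c (cross a b)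

lemma triple_eq (a b c : E3) : triple a b c =
    c 0 * (a 1 * b 2 - a 2 * b 1) + c 1 * (a 2 * b 0 - a 0 * b 2) +
      c 2 * (a 0 * b 1 - a 1 * b 0) := by
  simp [triple, inner_eq_coords]

lemma abs_triple_le_cross (a b c : E3) : |triple a b c| ≤ ‖c‖ * ‖cross a b‖ :=
  abs_real_inner_le_norm _ _

lemma abs_triple_le (a b c : E3) : |triple a b c| ≤ ‖a‖ * ‖b‖ * ‖c‖ := by
  refine (abs_triple_le_cross a b c).trans ?_
  rw [mul_comm]
  exact mul_le_mul_of_nonneg_right (norm_cross_le a b) (norm_nonneg c)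

/-- Cramer's rule for a vector orthogonal to `a × b`. -/
lemma smul_eq_of_inner_cross_eq_zero {a b m : E3} (h : inner ℝ m (cross a b) = 0) :
    (inner ℝ (cross a b) (cross a b) : ℝ) • m =
      triple m b (cross a b) • a + triple a m (cross a b) • b := by
  rw [inner_eq_coords, cross_zero_apply, cross_one_apply, cross_two_apply] at h
  rw [inner_eq_coords]
  simp only [triple_eq, cross_zero_apply, cross_one_apply, cross_two_apply]
  ext i
  fin_cases i
  · simp
    linear_combination (a 1 * b 2 - a 2 * b 1) * h
  · simp
    linear_combination (a 2 * b 0 - a 0 * b 2) * h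
  · simp
    linear_combination (a 0 * b 1 - a 1 * b 0) * h

/-- Six times the signed volume of a tetrahedron. -/
noncomputable def tetDet (T : Fin 4 → E3) : ℝ := triple (T 1 - T 0) (T 2 - T 0) (T 3 - T 0)

lemma tetVolume_eq (T : Fin 4 → E3) : tetVolume T = |tetDet T| / 6 := rfl

/-- The bordered determinant treats all vertices alike, so relabelling only changes the sign. This
is needed because `tetDist` allows any matching of vertices. -/
lemma tetDet_eq_det (T : Fin 4 → E3) :
    tetDet T = Matrix.det (Matrix.of fun i => ![1, T i 0, T i 1, T i 2]) := by
  rw [Matrix.det_succ_column_zero]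
  have h2 (i : Fin 3) : (2 : Fin 4).succAbove i = ![0, 1, 3] i := by fin_cases i <;> rfl
  have h1 (i : Fin 3) : (1 : Fin 4).succAbove i = ![0, 2, 3] i := by fin_cases i <;> rfl
  have h3 (i : Fin 3) : (3 : Fin 4).succAbove i = ![0, 1, 2] i := by fin_cases i <;> rfl
  simp [Fin.sum_univ_four, Matrix.det_fin_three, tetDet, triple_eq, h1, h2, h3]
  ring

lemma abs_tetDet_perm (T : Fin 4 → E3) (σ : Equiv.Perm (Fin 4)) :
    |tetDet (fun i => T (σ i))| = |tetDet T| := by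
  have h := Matrix.det_permute σ (Matrix.of fun i => ![1, T i 0, T i 1, T i 2])
  rw [tetDet_eq_det, tetDet_eq_det]
  have e : (Matrix.of fun i => ![1, T (σ i) 0, T (σ i) 1, T (σ i) 2]) =
      (Matrix.of fun i => ![1, T i 0, T i 1, T i 2]).submatrix σ id := rfl
  rw [e, h, abs_mul]
  rcases Int.units_eq_one_or (Equiv.Perm.sign σ) with h | h <;> simp [h]

lemma abs_tetDet_le_of_ne {T : Fin 4 → E3} {L : ℝ} (hT : ∀ i j, ‖T i - T j‖ ≤ L) {i j : Fin 4}
    (hij : i ≠ j) : |tetDet T| ≤ ‖T i - T j‖ * L ^ 2 := by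
  have hL : 0 ≤ L := (norm_nonneg _).trans (hT 0 0)
  obtain ⟨σ, h0, h1⟩ : ∃ σ : Equiv.Perm (Fin 4), σ 0 = j ∧ σ 1 = i := by
    revert i j; decide
  rw [← abs_tetDet_perm T σ]
  refine (abs_triple_le _ _ _).trans ?_
  simp only [h0, h1]
  rw [mul_assoc, sq]
  have h2 := hT (σ 2) j
  have h3 := hT (σ 3) j
  gcongr

/-! ### Voluminous tetrahedra -/

/-- With bounded edges, a large determinant forces every other quantity to be large: it is at most
an edge times the squared diameter, and equals up to sign the height times `‖cross‖`. The factor 64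
leaves room in each estimate. -/
lemma isVoluminous_of_tetDet {T : Fin 4 → E3} {θ d : ℝ} (hθ : 0 < θ) (hd : 0 < d)
    (hT : ∀ i, ‖T i - T 0‖ ≤ 2 * d) (hdet : 64 * θ * d ^ 3 ≤ |tetDet T|) :
    IsVoluminous θ d T := by
  have hpair : ∀ i j, ‖T i - T j‖ ≤ 4 * d := fun i j => by
    have := norm_sub_le_norm_sub_add_norm_sub (T i) (T 0) (T j)
    have h1 := hT i
    have h2 := hT j
    rw [norm_sub_rev] at h2
    linarith
  have hcr : 32 * θ * d ^ 2 ≤ ‖cross (T 1 - T 0) (T 2 - T 0)‖ := by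
    have h1 := hdet.trans (abs_triple_le_cross _ _ _)
    have h2 : 64 * θ * d ^ 3 ≤ 2 * d * ‖cross (T 1 - T 0) (T 2 - T 0)‖ := h1.trans (by
      gcongr; exact hT 3)
    nlinarith
  have hcr' : ‖cross (T 1 - T 0) (T 2 - T 0)‖ ≤ 4 * d ^ 2 := by
    refine (norm_cross_le _ _).trans ?_
    have h1 := hT 1
    have h2 := hT 2
    calc ‖T 1 - T 0‖ * ‖T 2 - T 0‖ ≤ (2 * d) * (2 * d) := by gcongr
      _ = 4 * d ^ 2 := by ring
  have hsin : θ ≤ Real.sin (InnerProductGeometry.angle (T 1 - T 0) (T 2 - T 0)) := by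
    have h1 := hT 1
    have h2 := hT 2
    have h3 := InnerProductGeometry.sin_angle_nonneg (T 1 - T 0) (T 2 - T 0)
    rw [norm_cross] at hcr
    have h4 : ‖T 1 - T 0‖ * ‖T 2 - T 0‖ ≤ 4 * d ^ 2 := by
      calc ‖T 1 - T 0‖ * ‖T 2 - T 0‖ ≤ (2 * d) * (2 * d) := by gcongr
        _ = 4 * d ^ 2 := by ring
    have h5 := hcr.trans (mul_le_mul_of_nonneg_right h4 h3)
    have h6 : 0 < 4 * d ^ 2 := by positivity
    nlinarith
  refine ⟨fun i => by simpa [dist_eq_norm] using hT i, fun i j hij => ?_, ⟨?_, ?_⟩, ?_⟩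
  · have h1 := hdet.trans (abs_tetDet_le_of_ne hpair hij)
    have h2 : 0 < d ^ 2 := by positivity
    nlinarith [norm_nonneg (T i - T j)]
  · exact hsin.trans (Real.sin_le (InnerProductGeometry.angle_nonneg _ _))
  · have h1 := Real.sin_le (sub_nonneg.2 (InnerProductGeometry.angle_le_pi (T 1 - T 0) (T 2 - T 0)))
    rw [Real.sin_pi_sub] at h1
    linarith
  · refine (Metric.le_infDist ((affineSpan_nonempty ℝ).2 ⟨T 0, by simp⟩)).2 fun q hq => ?_
    have hq0 : inner ℝ (q -ᵥ T 0) (cross (T 1 - T 0) (T 2 - T 0)) = 0 := by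
      have hq' := vsub_mem_vectorSpan_of_mem_affineSpan_of_mem_affineSpan hq
        (mem_affineSpan ℝ (show T 0 ∈ ({T 0, T 1, T 2} : Set E3) by simp))
      rw [vectorSpan_eq_span_vsub_set_right ℝ (show T 0 ∈ ({T 0, T 1, T 2} : Set E3) by simp)] at hq'
      generalize q -ᵥ T 0 = z at hq' ⊢
      induction hq' using Submodule.span_induction with
      | mem x hx =>
        obtain ⟨y, hy, rfl⟩ := hx
        simp only [Set.mem_insert_iff, Set.mem_singleton_iff] at hy
        rcases hy with rfl | rfl | rfl
        · simp
        · simp [inner_eq_coords]; ring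
        · simp [inner_eq_coords]; ring
      | zero => simp
      | add x y _ _ hx hy => rw [inner_add_left, hx, hy, add_zero]
      | smul c x _ hx => rw [inner_smul_left, hx, mul_zero]
    have h1 : tetDet T = inner ℝ (T 3 - q) (cross (T 1 - T 0) (T 2 - T 0)) := by
      have : T 3 - q = (T 3 - T 0) - (q -ᵥ T 0) := by rw [vsub_eq_sub]; abel
      rw [this, inner_sub_left, hq0, sub_zero]; rfl
    have h2 : 64 * θ * d ^ 3 ≤ dist (T 3) q * (4 * d ^ 2) := by
      refine hdet.trans ?_
      rw [h1, dist_eq_norm]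
      exact (abs_real_inner_le_norm _ _).trans (by gcongr)
    have h3 : 0 < d ^ 2 := by positivity
    nlinarith [mul_pos hθ hd]

/-- Trilinearity: the three vectors are exchanged one at a time. -/
lemma abs_triple_sub_triple_le {a b c a' b' c' : E3} {L ε : ℝ} (ha : ‖a‖ ≤ L)
    (hb : ‖b‖ ≤ L) (hb' : ‖b'‖ ≤ L) (hc : ‖c‖ ≤ L) (ha' : ‖a'‖ ≤ L) (hac : ‖a' - a‖ ≤ ε)
    (hbc : ‖b' - b‖ ≤ ε) (hcc : ‖c' - c‖ ≤ ε) :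
    |triple a' b' c' - triple a b c| ≤ 3 * ε * L ^ 2 := by
  have hL : 0 ≤ L := (norm_nonneg _).trans ha
  have hε : 0 ≤ ε := (norm_nonneg _).trans hac
  have e : triple a' b' c' - triple a b c =
      triple a' b' (c' - c) + triple a' (b' - b) c + triple (a' - a) b c := by
    simp only [triple_eq, PiLp.sub_apply]; ring
  rw [e]
  have h1 := abs_triple_le a' b' (c' - c)
  have h2 := abs_triple_le a' (b' - b) c
  have h3 := abs_triple_le (a' - a) b c
  have h1' : ‖a'‖ * ‖b'‖ * ‖c' - c‖ ≤ L * L * ε := by gcongr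
  have h2' : ‖a'‖ * ‖b' - b‖ * ‖c‖ ≤ L * ε * L := by gcongr
  have h3' : ‖a' - a‖ * ‖b‖ * ‖c‖ ≤ ε * L * L := by gcongr
  have := (abs_add_le (triple a' b' (c' - c) + triple a' (b' - b) c) (triple (a' - a) b c)).trans
    (add_le_add_left (abs_add_le _ _) _)
  nlinarith

lemma exists_perm_of_tetDist_le {T T' : Fin 4 → E3} {r : ℝ} (h : tetDist T T' ≤ r) :
    ∃ σ : Equiv.Perm (Fin 4), ∀ i, ‖T i - T' (σ i)‖ ≤ r := by
  obtain ⟨σ, hσ⟩ := exists_eq_ciInf_of_finite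
    (f := fun σ : Equiv.Perm (Fin 4) => ⨆ i : Fin 4, ‖T i - T' (σ i)‖)
  refine ⟨σ, fun i => ?_⟩
  refine (le_ciSup (f := fun i => ‖T i - T' (σ i)‖) (Set.finite_range _).bddAbove i).trans ?_
  rw [tetDist, ← hσ] at h
  exact h

lemma tetDist_le {T T' : Fin 4 → E3} {r : ℝ} (h : ∀ i, ‖T i - T' i‖ ≤ r) : tetDist T T' ≤ r :=
  (ciInf_le (Set.finite_range _).bddBelow (1 : Equiv.Perm (Fin 4))).trans (ciSup_le h)

/-- A fat tetrahedron and all its small perturbations, in whatever order of the vertices, are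
voluminous. -/
lemma isVoluminous_of_fat {T : Fin 4 → E3} {d : ℝ} (hd : 0 < d)
    (hT : ∀ i, ‖T i - T 0‖ ≤ 7 / 5 * d) (hdet : d ^ 3 / 8 ≤ |tetDet T|) :
    IsVoluminous (1 / 1000) d T ∧ ∀ T' : Fin 4 → E3, tetDist T' T ≤ (1 / 100000) * d →
      IsVoluminous (1 / 1000 / 2) (3 / 2 * d) T' := by
  have hd3 : 0 < d ^ 3 := by positivity
  refine ⟨isVoluminous_of_tetDet (by norm_num) hd (fun i => (hT i).trans (by linarith))
    (le_trans (by linarith) hdet), fun T' hT' => ?_⟩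
  obtain ⟨σ, hσ⟩ := exists_perm_of_tetDist_le hT'
  have hp : ∀ i j, ‖T i - T j‖ ≤ 14 / 5 * d := fun i j => by
    have := norm_sub_le_norm_sub_add_norm_sub (T i) (T 0) (T j)
    have h1 := hT i
    have h2 := hT j
    rw [norm_sub_rev] at h2
    linarith
  have hdiff : ∀ i, ‖(T' i - T' 0) - (T (σ i) - T (σ 0))‖ ≤ 2 / 100000 * d := fun i => by
    have e : (T' i - T' 0) - (T (σ i) - T (σ 0)) = (T' i - T (σ i)) - (T' 0 - T (σ 0)) := by abel
    rw [e]
    linarith [norm_sub_le (T' i - T (σ i)) (T' 0 - T (σ 0)), hσ i, hσ 0]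
  have hT'0 : ∀ i, ‖T' i - T' 0‖ ≤ 3 * d := fun i => by
    have := norm_le_norm_add_norm_sub' (T' i - T' 0) (T (σ i) - T (σ 0))
    linarith [hdiff i, hp (σ i) (σ 0)]
  -- Any vertex may become the base vertex, so all edges must be at most `3 d = 2 * (3 / 2 * d)`;
  -- the radius `7/5 * d` doubled leaves room. The determinant needed is `64 * (1/2000) * (27/8) *
  -- d³ = 0.108 d³`, below `d³ / 8` minus the perturbation error `0.00054 d³`.
  refine isVoluminous_of_tetDet (by norm_num) (by positivity) (fun i => (hT'0 i).trans
    (by linarith)) ?_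
  have hp' : ∀ i j, ‖T i - T j‖ ≤ 3 * d := fun i j => (hp i j).trans (by linarith)
  have h := abs_triple_sub_triple_le (hp' (σ 1) (σ 0)) (hp' (σ 2) (σ 0)) (hT'0 2)
    (hp' (σ 3) (σ 0)) (hT'0 1) (hdiff 1) (hdiff 2) (hdiff 3)
  have h2 := abs_tetDet_perm T σ
  change |tetDet T' - tetDet (fun i => T (σ i))| ≤ _ at h
  have h3 := abs_sub_abs_le_abs_sub (tetDet (fun i => T (σ i))) (tetDet T')
  rw [abs_sub_comm] at h3
  nlinarith

/-! ### Curvature of voluminous tetrahedra -/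

lemma linearIndependent_of_triple_ne_zero {a b c : E3} (h : triple a b c ≠ 0) :
    LinearIndependent ℝ ![a, b, c] := by
  rw [Fintype.linearIndependent_iff]
  intro g hg
  have hi (i : Fin 3) : g 0 * a i + g 1 * b i + g 2 * c i = 0 := by
    have := congrArg (fun x : E3 => x i) hg
    simpa [Fin.sum_univ_three] using this
  have h0 := hi 0
  have h1 := hi 1
  have h2 := hi 2
  rw [triple_eq] at h
  intro i
  refine (mul_eq_zero.1 ?_).resolve_right h
  fin_cases i
  · simp only [Fin.zero_eta]
    linear_combination (b 1 * c 2 - b 2 * c 1) * h0 + (b 2 * c 0 - b 0 * c 2) * h1 +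
      (b 0 * c 1 - b 1 * c 0) * h2
  · simp only [Fin.mk_one]
    linear_combination (c 1 * a 2 - c 2 * a 1) * h0 + (c 2 * a 0 - c 0 * a 2) * h1 +
      (c 0 * a 1 - c 1 * a 0) * h2
  · simp only [Fin.reduceFinMk]
    linear_combination (a 1 * b 2 - a 2 * b 1) * h0 + (a 2 * b 0 - a 0 * b 2) * h1 +
      (a 0 * b 1 - a 1 * b 0) * h2

lemma not_coplanar_of_tetDet_ne_zero {T : Fin 4 → E3} (h : tetDet T ≠ 0) :
    ¬ Coplanar ℝ (Set.range T) := by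
  intro hc
  have hli := linearIndependent_of_triple_ne_zero h
  have hcard := finrank_span_eq_card hli
  have hle : Submodule.span ℝ (Set.range ![T 1 - T 0, T 2 - T 0, T 3 - T 0]) ≤
      vectorSpan ℝ (Set.range T) := by
    rw [Submodule.span_le]
    rintro _ ⟨i, rfl⟩
    have hm (j : Fin 4) : T j - T 0 ∈ vectorSpan ℝ (Set.range T) :=
      vsub_mem_vectorSpan ℝ (Set.mem_range_self j) (Set.mem_range_self 0)
    fin_cases i
    exacts [hm 1, hm 2, hm 3]
  have h1 := Submodule.finrank_mono hle
  have h2 := hc.finrank_le_two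
  rw [hcard, Fintype.card_fin] at h1
  omega

lemma exists_smul_add_smul_eq {a b m : E3} (h : inner ℝ m (cross a b) = 0)
    (hn : cross a b ≠ 0) : ∃ s t : ℝ, m = s • a + t • b := by
  have h1 := smul_eq_of_inner_cross_eq_zero h
  have h2 : (inner ℝ (cross a b) (cross a b) : ℝ) ≠ 0 := inner_self_ne_zero.2 hn
  refine ⟨(inner ℝ (cross a b) (cross a b) : ℝ)⁻¹ * triple m b (cross a b),
    (inner ℝ (cross a b) (cross a b) : ℝ)⁻¹ * triple a m (cross a b), ?_⟩
  rw [mul_smul, mul_smul, ← smul_add, ← h1, smul_smul, inv_mul_cancel₀ h2, one_smul]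

/-- The foot of the perpendicular, `x - c • n`, lies in the plane by Cramer's rule, and the distance
to it is `|c| * ‖n‖`. -/
lemma infDist_mul_norm_cross_le (p q r x : E3) :
    Metric.infDist x (affineSpan ℝ {p, q, r} : Set E3) * ‖cross (q - p) (r - p)‖ ≤
      |triple (q - p) (r - p) (x - p)| := by
  set n := cross (q - p) (r - p) with hn
  by_cases h0 : n = 0
  · simp [h0]
  have hnn : (0 : ℝ) < ‖n‖ := norm_pos_iff.2 h0
  set c : ℝ := inner ℝ (x - p) n / ‖n‖ ^ 2 with hc
  have horth : inner ℝ (x - p - c • n) (cross (q - p) (r - p)) = 0 := by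
    rw [← hn, inner_sub_left, inner_smul_left, real_inner_self_eq_norm_sq, hc]
    simp only [conj_trivial]
    field_simp
    ring
  obtain ⟨s, t, hst⟩ := exists_smul_add_smul_eq horth h0
  have hmem : x - c • n ∈ affineSpan ℝ ({p, q, r} : Set E3) := by
    have e : x - c • n = (s • (q -ᵥ p) + t • (r -ᵥ p)) +ᵥ p := by
      simp only [vsub_eq_sub, vadd_eq_add]
      rw [← hst]; abel
    rw [e]
    have hp := mem_affineSpan ℝ (show p ∈ ({p, q, r} : Set E3) by simp)
    have hq := mem_affineSpan ℝ (show q ∈ ({p, q, r} : Set E3) by simp)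
    have hr := mem_affineSpan ℝ (show r ∈ ({p, q, r} : Set E3) by simp)
    refine AffineSubspace.vadd_mem_of_mem_direction ?_ hp
    exact Submodule.add_mem _ (Submodule.smul_mem _ _ (AffineSubspace.vsub_mem_direction hq hp))
      (Submodule.smul_mem _ _ (AffineSubspace.vsub_mem_direction hr hp))
  have h1 : Metric.infDist x (affineSpan ℝ {p, q, r} : Set E3) ≤ |c| * ‖n‖ := by
    refine (Metric.infDist_le_dist_of_mem hmem).trans ?_
    rw [dist_eq_norm, sub_sub_cancel, norm_smul, Real.norm_eq_abs]
  refine (mul_le_mul_of_nonneg_right h1 hnn.le).trans (le_of_eq ?_)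
  rw [hc, abs_div, abs_of_pos (by positivity : 0 < ‖n‖ ^ 2)]
  change _ = |inner ℝ (x - p) n|
  field_simp

lemma triangleArea_le {a b c : E3} {L : ℝ} (hb : ‖b - a‖ ≤ L) (hc : ‖c - a‖ ≤ L) :
    triangleArea a b c ≤ L ^ 2 / 2 := by
  have hL : 0 ≤ L := (norm_nonneg _).trans hb
  have h1 := norm_cross_le (b - a) (c - a)
  have h2 : ‖b - a‖ * ‖c - a‖ ≤ L * L := by gcongr
  unfold triangleArea
  nlinarith

lemma curvature_ge_of_isVoluminous {θ d : ℝ} {T : Fin 4 → E3} (hθ : 0 < θ) (hd : 0 < d)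
    (h : IsVoluminous θ d T) : θ ^ 4 / (6144 * d) ≤ curvature T := by
  have hT (i) : ‖T i - T 0‖ ≤ 2 * d := by simpa [dist_eq_norm] using h.mem_ball i
  have hpair : ∀ i j, ‖T i - T j‖ ≤ 4 * d := fun i j => by
    have := norm_sub_le_norm_sub_add_norm_sub (T i) (T 0) (T j)
    have h1 := hT i
    have h2 := hT j
    rw [norm_sub_rev] at h2
    linarith
  obtain ⟨ha1, ha2⟩ := h.angle_mem
  have hsin : θ / 2 ≤ Real.sin (InnerProductGeometry.angle (T 1 - T 0) (T 2 - T 0)) := by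
    have hmono : ∀ t, θ ≤ t → t ≤ Real.pi / 2 → θ / 2 ≤ Real.sin t := fun t h1 h2 => by
      have h3 := Real.mul_le_sin (hθ.le.trans h1) h2
      have h4 : 1 / 2 ≤ 2 / Real.pi := by
        rw [div_le_div_iff₀ two_pos Real.pi_pos]; linarith [Real.pi_le_four]
      nlinarith
    rcases le_total (InnerProductGeometry.angle (T 1 - T 0) (T 2 - T 0)) (Real.pi / 2) with h1 | h1
    · exact hmono _ ha1 h1
    · rw [← Real.sin_pi_sub]
      exact hmono _ (by linarith) (by linarith)
  have hcr : (θ * d) * (θ * d) * (θ / 2) ≤ ‖cross (T 1 - T 0) (T 2 - T 0)‖ := by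
    rw [norm_cross]
    have h1 := h.separated 1 0 (by decide)
    have h2 := h.separated 2 0 (by decide)
    gcongr
  have hdet : θ ^ 4 * d ^ 3 / 2 ≤ |tetDet T| := by
    refine le_trans ?_ (infDist_mul_norm_cross_le (T 0) (T 1) (T 2) (T 3))
    calc θ ^ 4 * d ^ 3 / 2 = (θ * d) * ((θ * d) * (θ * d) * (θ / 2)) := by ring
      _ ≤ _ := mul_le_mul h.height hcr (by positivity) Metric.infDist_nonneg
  have hpos : 0 < |tetDet T| := lt_of_lt_of_le (by positivity) hdet
  rw [curvature, if_neg (not_coplanar_of_tetDet_ne_zero (abs_pos.1 hpos)), tetVolume_eq]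
  have hA : tetArea T ≤ 32 * d ^ 2 := by
    have h1 := triangleArea_le (hpair 1 0) (hpair 2 0)
    have h2 := triangleArea_le (hpair 2 0) (hpair 3 0)
    have h3 := triangleArea_le (hpair 1 0) (hpair 3 0)
    have h4 := triangleArea_le (hpair 2 1) (hpair 3 1)
    unfold tetArea
    nlinarith
  have hA0 : 0 < tetArea T := by
    have h1 : 0 < triangleArea (T 0) (T 1) (T 2) :=
      div_pos (lt_of_lt_of_le (by positivity) hcr) two_pos
    have h2 : 0 ≤ triangleArea (T 0) (T 2) (T 3) := by unfold triangleArea; positivity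
    have h3 : 0 ≤ triangleArea (T 0) (T 1) (T 3) := by unfold triangleArea; positivity
    have h4 : 0 ≤ triangleArea (T 1) (T 2) (T 3) := by unfold triangleArea; positivity
    unfold tetArea
    linarith
  have hD : Metric.diam (Set.range T) ≤ 4 * d := by
    refine Metric.diam_le_of_forall_dist_le (by positivity) ?_
    rintro _ ⟨i, rfl⟩ _ ⟨j, rfl⟩
    rw [dist_eq_norm]
    exact hpair i j
  have hD0 : 0 < Metric.diam (Set.range T) := by
    have h1 := Metric.dist_le_diam_of_mem (Set.finite_range T).isBounded
      (Set.mem_range_self 1) (Set.mem_range_self 0)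
    have h2 := h.separated 1 0 (by decide)
    rw [dist_eq_norm] at h1
    exact lt_of_lt_of_le (by positivity) (h2.trans h1)
  -- Four faces of area at most `(4 d)² / 2` and diameter at most `4 d`: `6144 = 2 * 6 * 32 * 16`.
  calc θ ^ 4 / (6144 * d) = (θ ^ 4 * d ^ 3 / 2 / 6) / (32 * d ^ 2 * (4 * d) ^ 2) := by
        field_simp; norm_num
    _ ≤ _ := by gcongr

/-! ### Lower energy bounds -/

/-- Each of the nested integrals is compared with a constant on `A i`, so measurability of the
integrand is not needed. -/
lemma mengerEnergy_ge_of_subset {p κ : ℝ} (hp : 0 ≤ p) (hκ : 0 ≤ κ) {S : Set E3}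
    {A : Fin 4 → Set E3} (hA : ∀ i, MeasurableSet (A i)) (hAS : ∀ i, A i ⊆ S)
    (h : ∀ x₀ ∈ A 0, ∀ x₁ ∈ A 1, ∀ x₂ ∈ A 2, ∀ x₃ ∈ A 3, κ ≤ curvature ![x₀, x₁, x₂, x₃]) :
    ENNReal.ofReal (κ ^ p) * H2 (A 3) * H2 (A 2) * H2 (A 1) * H2 (A 0) ≤ mengerEnergy p S := by
  have step : ∀ (i : Fin 4) (f : E3 → ℝ≥0∞) (c : ℝ≥0∞), (∀ x ∈ A i, c ≤ f x) →
      c * H2 (A i) ≤ ∫⁻ x in S, f x ∂H2 := fun i f c hf =>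
    calc c * H2 (A i) = ∫⁻ _ in A i, c ∂H2 := (setLIntegral_const _ _).symm
      _ ≤ ∫⁻ x in A i, f x ∂H2 := setLIntegral_mono' (hA i) hf
      _ ≤ ∫⁻ x in S, f x ∂H2 := lintegral_mono_set (hAS i)
  refine step 0 _ _ fun x₀ h₀ => step 1 _ _ fun x₁ h₁ => step 2 _ _ fun x₂ h₂ =>
    step 3 _ _ fun x₃ h₃ => ?_
  exact ENNReal.ofReal_le_ofReal (Real.rpow_le_rpow hκ (h x₀ h₀ x₁ h₁ x₂ h₂ x₃ h₃) hp)

lemma mengerEnergy_ge_of_tetrahedron {p α η d β : ℝ} (hp : 0 ≤ p) (hη : 0 < η)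
    (hd : 0 < d) (hβ : 0 ≤ β) {S : Set E3} (hS : IsCompact S) {T : Fin 4 → E3}
    (hT : ∀ T' : Fin 4 → E3, tetDist T' T ≤ α * d → IsVoluminous (η / 2) (3 / 2 * d) T')
    (hβS : ∀ i, ENNReal.ofReal (β * d ^ 2) ≤ H2 (S ∩ Metric.closedBall (T i) (α * d))) :
    ENNReal.ofReal ((η ^ 4 / 147456) ^ p * β ^ 4 * d ^ (8 - p)) ≤ mengerEnergy p S := by
  -- The curvature bound for the parameters `η / 2` and `3 / 2 * d`: `147456 = 16 * 6144 * 3 / 2`.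
  set κ := η ^ 4 / (147456 * d) with hκ
  have key := mengerEnergy_ge_of_subset (κ := κ) hp (by positivity) (S := S)
    (A := fun i => S ∩ Metric.closedBall (T i) (α * d))
    (fun i => (hS.isClosed.inter Metric.isClosed_closedBall).measurableSet)
    (fun i => Set.inter_subset_left) (by
      rintro x₀ ⟨-, h₀⟩ x₁ ⟨-, h₁⟩ x₂ ⟨-, h₂⟩ x₃ ⟨-, h₃⟩
      have hv := hT ![x₀, x₁, x₂, x₃] (tetDist_le fun i => by
        rw [← dist_eq_norm]
        fin_cases i
        exacts [h₀, h₁, h₂, h₃])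
      refine le_trans (le_of_eq ?_) (curvature_ge_of_isVoluminous (by positivity) (by positivity) hv)
      rw [hκ]
      field_simp
      norm_num)
  refine le_trans ?_ key
  have e : (η ^ 4 / 147456) ^ p * β ^ 4 * d ^ (8 - p) =
      κ ^ p * (β * d ^ 2) * (β * d ^ 2) * (β * d ^ 2) * (β * d ^ 2) := by
    rw [hκ, ← div_div, Real.div_rpow (by positivity) hd.le, Real.rpow_sub hd]
    have : d ^ (8 : ℝ) = d ^ 8 := by exact_mod_cast Real.rpow_natCast d 8
    rw [this]
    have := Real.rpow_pos_of_pos hd p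
    field_simp
  rw [e, ENNReal.ofReal_mul (by positivity), ENNReal.ofReal_mul (by positivity),
    ENNReal.ofReal_mul (by positivity), ENNReal.ofReal_mul (by positivity)]
  gcongr
  exacts [hβS 3, hβS 2, hβS 1, hβS 0]

/-! ### Large projections -/

lemma subset_or_subset_of_disjoint_frontier {X : Type*} [TopologicalSpace X] {U K : Set X}
    (hU : IsOpen U) (hK : IsPreconnected K) (h : Disjoint K (frontier U)) :
    K ⊆ U ∨ K ⊆ (closure U)ᶜ := by
  refine hK.subset_or_subset hU isClosed_closure.isOpen_compl
    (Set.disjoint_compl_right_iff_subset.2 subset_closure) fun x hx => ?_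
  by_contra hx'
  simp only [Set.mem_union, Set.mem_compl_iff, not_or, not_not] at hx'
  exact Set.disjoint_left.1 h hx (hU.frontier_eq ▸ ⟨hx'.2, hx'.1⟩)

lemma exists_mem_frontier_of_mem_closure {X : Type*} [TopologicalSpace X] {U K : Set X}
    (hU : IsOpen U) (hK : IsPreconnected K) {y z : X} (hy : y ∈ K) (hz : z ∈ K)
    (hyU : y ∈ closure U) (hzU : z ∉ U) : ∃ x ∈ K, x ∈ frontier U := by
  by_contra! hcon
  rcases subset_or_subset_of_disjoint_frontier hU hK (Set.disjoint_left.2 hcon) with h | h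
  · exact hzU (h hz)
  · exact h hy hyU

/-- The cap of opening angle `π/4` around `w` of the sphere of radius `r` about `x₀` lies in
`closure U`, and the opposite cap in the complement of `U`. -/
def HasCaps (U : Set E3) (x₀ : E3) (r : ℝ) (w : E3) : Prop :=
  ∀ y : E3, ‖y‖ = r → r ≤ √2 * inner ℝ y w → x₀ + y ∈ closure U ∧ x₀ - y ∉ U

/-- The surface `frontier U` meets every line segment orthogonal to a disc of radius `r / √2`
which joins two opposite caps. -/
lemma HasCaps.exists_add_smul_mem_frontier {U : Set E3} (hU : IsOpen U) {x₀ w : E3} {r : ℝ}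
    (hr : 0 < r) (hw : ‖w‖ = 1) (h : HasCaps U x₀ r w) {z : E3} (hz : inner ℝ z w = 0)
    (hzr : ‖z‖ ≤ r / √2) :
    ∃ t : ℝ, x₀ + z + t • w ∈ frontier U ∧ ‖z + t • w‖ ≤ r := by
  have h2 : (0 : ℝ) < √2 := by positivity
  have hsq2 : √2 ^ 2 = 2 := Real.sq_sqrt (by norm_num)
  have hnorm (t : ℝ) : ‖z + t • w‖ ^ 2 = ‖z‖ ^ 2 + t ^ 2 := by
    rw [norm_add_sq_real, inner_smul_right, hz, norm_smul, hw, Real.norm_eq_abs, mul_one, sq_abs]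
    ring
  have hz2 : 2 * ‖z‖ ^ 2 ≤ r ^ 2 := by
    have h3 : √2 * ‖z‖ ≤ r := by rwa [mul_comm, ← le_div_iff₀ h2]
    have h4 : (√2 * ‖z‖) ^ 2 ≤ r ^ 2 := by gcongr
    rwa [mul_pow, hsq2] at h4
  -- The points `z ± s • w` lie on the sphere of radius `r`, and `‖z‖ ≤ r / √2` puts them in the
  -- opposite caps.
  set s := √(r ^ 2 - ‖z‖ ^ 2) with hs
  have hs2 : s ^ 2 = r ^ 2 - ‖z‖ ^ 2 := Real.sq_sqrt (by nlinarith [sq_nonneg ‖z‖])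
  have hs0 : 0 ≤ s := Real.sqrt_nonneg _
  have hrs : r ≤ √2 * s := by
    refine (sq_le_sq₀ hr.le (by positivity)).1 ?_
    rw [mul_pow, hsq2, hs2]; linarith
  have hn (t : ℝ) (ht : t ^ 2 = s ^ 2) : ‖z + t • w‖ = r := by
    refine (sq_eq_sq₀ (norm_nonneg _) hr.le).1 ?_
    rw [hnorm, ht, hs2]; ring
  have hin (t : ℝ) : inner ℝ (z + t • w) w = t := by
    rw [inner_add_left, hz, inner_smul_left, real_inner_self_eq_norm_sq, hw]; simp
  have hp := (h (z + s • w) (hn s rfl) (by rw [hin]; exact hrs)).1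
  have hm := (h (-(z + (-s) • w)) (by rw [norm_neg]; exact hn _ (by ring))
    (by rw [inner_neg_left, hin, neg_neg]; exact hrs)).2
  have hK : IsPreconnected ((fun t : ℝ => x₀ + z + t • w) '' Set.Icc (-s) s) :=
    isPreconnected_Icc.image _ (by fun_prop)
  obtain ⟨_, ⟨t, ht, rfl⟩, hx⟩ := exists_mem_frontier_of_mem_closure hU hK
    ⟨s, ⟨by linarith, le_rfl⟩, rfl⟩ ⟨-s, ⟨le_rfl, by linarith⟩, rfl⟩
    (by simpa only [add_assoc] using hp) (by simpa only [sub_neg_eq_add, add_assoc] using hm)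
  refine ⟨t, hx, (sq_le_sq₀ (norm_nonneg _) hr.le).1 ?_⟩
  rw [hnorm]
  nlinarith [abs_le.2 ht, sq_le_sq' ht.1 ht.2]

lemma finrank_orthogonal_unit {w : E3} (hw : ‖w‖ = 1) : Module.finrank ℝ (ℝ ∙ w)ᗮ = 2 := by
  have : Fact (Module.finrank ℝ E3 = 2 + 1) := ⟨by simp⟩
  exact Submodule.finrank_orthogonal_span_singleton (by rintro rfl; simp at hw)

lemma HasCaps.large_projection {U : Set E3} (hU : IsOpen U) {x₀ w : E3} {r : ℝ}
    (hr : 0 < r) (hw : ‖w‖ = 1) (h : HasCaps U x₀ r w) :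
    (AffineSubspace.mk' x₀ (ℝ ∙ w)ᗮ : Set E3) ∩ Metric.closedBall x₀ (r / √2) ⊆
      (fun y : E3 =>
        (EuclideanGeometry.orthogonalProjection (AffineSubspace.mk' x₀ (ℝ ∙ w)ᗮ) y : E3)) ''
        (frontier U ∩ Metric.closedBall x₀ r) := by
  rintro z ⟨hz, hzr⟩
  rw [SetLike.mem_coe, AffineSubspace.mem_mk', vsub_eq_sub, Submodule.mem_orthogonal_singleton_iff_inner_left] at hz
  rw [mem_closedBall_iff_norm] at hzr
  obtain ⟨t, ht, htr⟩ := h.exists_add_smul_mem_frontier hU hr hw hz hzr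
  have e : x₀ + (z - x₀) + t • w = z + t • w := by abel
  refine ⟨z + t • w, ⟨e ▸ ht, ?_⟩, ?_⟩
  · rw [mem_closedBall_iff_norm]
    rwa [show z + t • w - x₀ = z - x₀ + t • w by abel]
  · refine EuclideanGeometry.coe_orthogonalProjection_eq_iff_mem.2 ⟨?_, ?_⟩
    · rwa [AffineSubspace.mem_mk', vsub_eq_sub, Submodule.mem_orthogonal_singleton_iff_inner_left]
    · rw [vsub_eq_sub, add_sub_cancel_left, AffineSubspace.direction_mk']
      exact Submodule.le_orthogonal_orthogonal _
        (Submodule.smul_mem _ _ (Submodule.mem_span_singleton_self w))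

lemma euclideanHausdorffMeasure_image_le_of_lipschitzWith_one {X Y : Type*} [EMetricSpace X]
    [MeasurableSpace X] [BorelSpace X] [EMetricSpace Y] [MeasurableSpace Y] [BorelSpace Y]
    {f : X → Y} (hf : LipschitzWith 1 f) (d : ℕ) (s : Set X) :
    (μHE[d] : Measure Y) (f '' s) ≤ (μHE[d] : Measure X) s := by
  have h := hf.hausdorffMeasure_image_le (Nat.cast_nonneg (α := ℝ) d) s
  rw [ENNReal.coe_one, ENNReal.one_rpow, one_mul] at h
  rw [Measure.euclideanHausdorffMeasure_def, Measure.euclideanHausdorffMeasure_def,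
    Measure.smul_apply, Measure.smul_apply]
  gcongr

lemma exists_orthonormal_pair {w : E3} (hw : ‖w‖ = 1) :
    ∃ e₁ e₂ : E3, ‖e₁‖ = 1 ∧ ‖e₂‖ = 1 ∧ inner ℝ e₁ e₂ = 0 ∧ inner ℝ e₁ w = 0 ∧
      inner ℝ e₂ w = 0 := by
  let b := (stdOrthonormalBasis ℝ (ℝ ∙ w)ᗮ).reindex (finCongr (finrank_orthogonal_unit hw))
  refine ⟨b 0, b 1, b.orthonormal.1 0, b.orthonormal.1 1, b.orthonormal.2 (by decide), ?_, ?_⟩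
  · exact Submodule.mem_orthogonal_singleton_iff_inner_left.1 (b 0).2
  · exact Submodule.mem_orthogonal_singleton_iff_inner_left.1 (b 1).2

/-- The projection onto `wᗮ`, read in orthonormal coordinates, is 1-Lipschitz and its image contains
a disc of radius `r / √2`. -/
lemma HasCaps.lower_area {U : Set E3} (hU : IsOpen U) {x₀ w : E3} {r : ℝ}
    (hr : 0 < r) (hw : ‖w‖ = 1) (h : HasCaps U x₀ r w) :
    ENNReal.ofReal (Real.pi / 2 * r ^ 2) ≤ H2 (frontier U ∩ Metric.closedBall x₀ r) := by
  let b := (stdOrthonormalBasis ℝ (ℝ ∙ w)ᗮ).reindex (finCongr (finrank_orthogonal_unit hw))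
  let f : E3 → EuclideanSpace ℝ (Fin 2) := fun y =>
    b.repr ((ℝ ∙ w)ᗮ.orthogonalProjectionOnto (y - x₀))
  have hf : LipschitzWith 1 f := by
    refine LipschitzWith.of_dist_le_mul fun y z => ?_
    rw [NNReal.coe_one, one_mul, b.repr.dist_map, dist_eq_norm, dist_eq_norm, ← map_sub]
    refine (Submodule.norm_orthogonalProjectionOnto_apply_le _ _).trans (le_of_eq ?_)
    congr 1; abel
  have hsub : Metric.closedBall (0 : EuclideanSpace ℝ (Fin 2)) (r / √2) ⊆
      f '' (frontier U ∩ Metric.closedBall x₀ r) := by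
    intro c hc
    rw [mem_closedBall_zero_iff] at hc
    obtain ⟨t, ht, htr⟩ := h.exists_add_smul_mem_frontier hU hr hw (z := (b.repr.symm c : E3))
      (Submodule.mem_orthogonal_singleton_iff_inner_left.1 (b.repr.symm c).2)
      (by rwa [Submodule.norm_coe, b.repr.symm.norm_map])
    have e : x₀ + (b.repr.symm c : E3) + t • w - x₀ = (b.repr.symm c : E3) + t • w := by abel
    refine ⟨_, ⟨ht, ?_⟩, ?_⟩
    · rw [mem_closedBall_iff_norm]
      rwa [e]
    · change b.repr _ = c
      rw [e, map_add, map_smul]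
      rw [Submodule.orthogonalProjectionOnto_orthogonal_apply_eq_zero
        (Submodule.mem_span_singleton_self w), smul_zero, add_zero,
        Submodule.orthogonalProjectionOnto_mem_subspace_eq_self, LinearIsometryEquiv.apply_symm_apply]
  have h1 := (measure_mono hsub).trans
    (euclideanHausdorffMeasure_image_le_of_lipschitzWith_one hf 2 _)
  rw [EuclideanSpace.euclideanHausdorffMeasure_eq_volume, EuclideanSpace.volume_closedBall_fin_two,
    ← ENNReal.ofReal_pow (by positivity), ← ENNReal.ofReal_mul (by positivity), div_pow,
    Real.sq_sqrt (by norm_num)] at h1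
  refine le_trans (le_of_eq ?_) h1
  congr 1; ring

/-! ### Existence of stopping distances -/

open Filter Topology

/-- The ray along `w` from the centre of the cap must leave the bounded set `U`, so it meets the
frontier at distance at least `r` from `x₀`. -/
lemma HasCaps.le_diam {U : Set E3} (hU : IsOpen U) (hUb : Bornology.IsBounded U) {x₀ w : E3}
    {r : ℝ} (hx₀ : x₀ ∈ frontier U) (hr : 0 < r) (hw : ‖w‖ = 1) (h : HasCaps U x₀ r w) :
    r ≤ Metric.diam (frontier U) := by
  have hin : inner ℝ w w = (1 : ℝ) := by rw [real_inner_self_eq_norm_sq, hw]; norm_num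
  have h1 : x₀ + r • w ∈ closure U := by
    refine (h (r • w) (by rw [norm_smul, hw, mul_one, Real.norm_of_nonneg hr.le]) ?_).1
    rw [inner_smul_left, hin, conj_trivial, mul_one]
    have : 1 ≤ √2 := by rw [Real.one_le_sqrt]; norm_num
    nlinarith
  obtain ⟨R, hR⟩ := hUb.subset_closedBall x₀
  have hK : IsPreconnected ((fun t : ℝ => x₀ + t • w) '' Set.Ici r) :=
    isPreconnected_Ici.image _ (by fun_prop)
  have hfar : x₀ + (max r (R + 1)) • w ∉ U := fun hmem => by
    have := hR hmem
    rw [mem_closedBall_iff_norm, add_sub_cancel_left, norm_smul, hw, mul_one, Real.norm_eq_abs] at this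
    linarith [le_abs_self (max r (R + 1)), le_max_right r (R + 1)]
  obtain ⟨_, ⟨t, ht, rfl⟩, hx⟩ := exists_mem_frontier_of_mem_closure hU hK
    ⟨r, Set.self_mem_Ici, rfl⟩ ⟨max r (R + 1), Set.mem_Ici.2 (le_max_left _ _), rfl⟩ h1 hfar
  have hb : Bornology.IsBounded (frontier U) := hUb.closure.subset frontier_subset_closure
  refine le_trans ?_ (Metric.dist_le_diam_of_mem hb hx hx₀)
  rw [dist_eq_norm, add_sub_cancel_left, norm_smul, hw, mul_one]
  exact (Set.mem_Ici.1 ht).trans (le_abs_self t)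

/-- Both cap conditions are closed, so they survive a limit of radii along which the unit axes
converge. -/
lemma exists_hasCaps_of_forall_lt {U : Set E3} (hU : IsOpen U) {x₀ : E3} {d : ℝ} (hd : 0 < d)
    (h : ∀ r, 0 < r → r < d → ∃ w : E3, ‖w‖ = 1 ∧ HasCaps U x₀ r w) :
    ∃ w : E3, ‖w‖ = 1 ∧ HasCaps U x₀ d w := by
  obtain ⟨q, hq0, hq1, hqt⟩ : ∃ q : ℕ → ℝ, (∀ n, 0 < q n) ∧ (∀ n, q n < 1) ∧
      Tendsto q atTop (𝓝 1) := exists_seq_strictMono_tendsto' (zero_lt_one' ℝ) |>.elim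
    fun q hq => ⟨q, fun n => (hq.2.1 n).1, fun n => (hq.2.1 n).2, hq.2.2⟩
  choose w hw1 hw using fun n => h (q n * d) (by have := hq0 n; positivity)
    (by have := hq1 n; nlinarith)
  obtain ⟨w₀, hw₀, φ, hφ, hlim⟩ := (isCompact_sphere (0 : E3) 1).tendsto_subseq
    (x := w) (fun n => by simpa using hw1 n)
  have hw₀1 : ‖w₀‖ = 1 := by simpa using hw₀
  have hs2 : 1 < √2 := by rw [Real.lt_sqrt] <;> norm_num
  have hin : inner ℝ w₀ w₀ = (1 : ℝ) := by rw [real_inner_self_eq_norm_sq, hw₀1]; norm_num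
  have hstrict : ∀ y : E3, ‖y‖ = d → d < √2 * inner ℝ y w₀ → x₀ + y ∈ closure U ∧ x₀ - y ∉ U := by
    intro y hy hyw
    have hev : ∀ᶠ n in atTop, d < √2 * inner ℝ y (w (φ n)) :=
      (tendsto_const_nhds.mul (tendsto_const_nhds.inner hlim)).eventually_const_lt hyw
    have hall : ∀ᶠ n in atTop, x₀ + q (φ n) • y ∈ closure U ∧ x₀ - q (φ n) • y ∈ Uᶜ := by
      filter_upwards [hev] with n hn
      refine hw (φ n) _ ?_ ?_
      · rw [norm_smul, hy, Real.norm_of_nonneg (hq0 _).le]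
      · rw [inner_smul_left, conj_trivial]
        have := hq0 (φ n)
        nlinarith
    have hqy : Tendsto (fun n => q (φ n) • y) atTop (𝓝 y) := by
      simpa using (hqt.comp hφ.tendsto_atTop).smul_const y
    exact ⟨isClosed_closure.mem_of_tendsto (tendsto_const_nhds.add hqy)
      (hall.mono fun n hn => hn.1), hU.isClosed_compl.mem_of_tendsto
      (tendsto_const_nhds.sub hqy) (hall.mono fun n hn => hn.2)⟩
  refine ⟨w₀, hw₀1, fun y hy hyw => ?_⟩
  have hy0 : y ≠ 0 := by rintro rfl; rw [norm_zero] at hy; exact hd.ne hy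
  -- A point on the rim of the limit cap is approached by points of the open cap: tilt it towards
  -- `w₀` and rescale to norm `d`.
  let g : ℝ → E3 := fun ε => (d / ‖y + ε • w₀‖) • (y + ε • w₀)
  have hg : ContinuousAt g 0 := by
    have h1 : ContinuousAt (fun ε : ℝ => y + ε • w₀) 0 := by fun_prop
    exact (continuousAt_const.div h1.norm (by simpa using hy0)).smul h1
  have hg0 : g 0 = y := by simp [g, hy, div_self hd.ne']
  have hgt : Tendsto g (𝓝[>] 0) (𝓝 y) := by
    rw [← hg0]; exact hg.tendsto.mono_left nhdsWithin_le_nhds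
  have hgm : ∀ᶠ ε in 𝓝[>] (0 : ℝ), x₀ + g ε ∈ closure U ∧ x₀ - g ε ∈ Uᶜ := by
    filter_upwards [self_mem_nhdsWithin] with ε hε
    rw [Set.mem_Ioi] at hε
    have hlow : d + √2 * ε ≤ √2 * inner ℝ (y + ε • w₀) w₀ := by
      rw [inner_add_left, inner_smul_left, conj_trivial, hin]; linarith
    have hup : ‖y + ε • w₀‖ ≤ d + ε := by
      refine (norm_add_le _ _).trans ?_
      rw [hy, norm_smul, hw₀1, mul_one, Real.norm_of_nonneg hε.le]
    have hlt : ‖y + ε • w₀‖ < √2 * inner ℝ (y + ε • w₀) w₀ := by nlinarith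
    have hpos : 0 < ‖y + ε • w₀‖ := by
      rw [norm_pos_iff]
      intro h0
      rw [h0] at hlt
      simp at hlt
    refine hstrict _ ?_ ?_
    · rw [norm_smul, Real.norm_of_nonneg (by positivity)]
      field_simp
    · rw [inner_smul_left, conj_trivial]
      calc d = d / ‖y + ε • w₀‖ * ‖y + ε • w₀‖ := by field_simp
        _ < d / ‖y + ε • w₀‖ * (√2 * inner ℝ (y + ε • w₀) w₀) := by gcongr
        _ = _ := by ring
  exact ⟨isClosed_closure.mem_of_tendsto (tendsto_const_nhds.add hgt)
    (hgm.mono fun n hn => hn.1), hU.isClosed_compl.mem_of_tendsto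
    (tendsto_const_nhds.sub hgt) (hgm.mono fun n hn => hn.2)⟩

lemma triple_sq (a b c : E3) : triple a b c ^ 2 =
    inner ℝ a a * (inner ℝ b b * inner ℝ c c - inner ℝ b c * inner ℝ b c) -
    inner ℝ a b * (inner ℝ a b * inner ℝ c c - inner ℝ b c * inner ℝ a c) +
    inner ℝ a c * (inner ℝ a b * inner ℝ b c - inner ℝ b b * inner ℝ a c) := by
  simp only [inner_eq_coords, triple_eq]
  ring

/-- The frontier contains two points near `x₀` in roughly orthogonal directions. -/
lemma HasCaps.exists_cross {U : Set E3} (hU : IsOpen U) {x₀ w : E3} {r : ℝ}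
    (hr : 0 < r) (hw : ‖w‖ = 1) (h : HasCaps U x₀ r w) :
    ∃ a b : E3, x₀ + a ∈ frontier U ∧ x₀ + b ∈ frontier U ∧ ‖a‖ ≤ r ∧ ‖b‖ ≤ r ∧
      |inner ℝ w (cross a b)| = r ^ 2 / 2 := by
  obtain ⟨e₁, e₂, h1, h2, h12, h1w, h2w⟩ := exists_orthonormal_pair hw
  have hsq : (r / √2) ^ 2 = r ^ 2 / 2 := by rw [div_pow, Real.sq_sqrt (by norm_num)]
  have hρ : 0 ≤ r / √2 := by positivity
  have key : ∀ e : E3, ‖e‖ = 1 → inner ℝ e w = 0 → ∃ t : ℝ,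
      x₀ + ((r / √2) • e + t • w) ∈ frontier U ∧ ‖(r / √2) • e + t • w‖ ≤ r := by
    intro e he hew
    obtain ⟨t, ht, ht'⟩ := h.exists_add_smul_mem_frontier hU hr hw (z := (r / √2) • e)
      (by rw [inner_smul_left, hew, mul_zero])
      (by rw [norm_smul, he, mul_one, Real.norm_of_nonneg hρ])
    exact ⟨t, by rwa [← add_assoc], ht'⟩
  obtain ⟨s, hs, hs'⟩ := key e₁ h1 h1w
  obtain ⟨t, ht, ht'⟩ := key e₂ h2 h2w
  refine ⟨_, _, hs, ht, hs', ht', ?_⟩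
  -- The unknown heights `s`, `t` drop out of the component of the cross product along `w`.
  have e : inner ℝ w (cross ((r / √2) • e₁ + s • w) ((r / √2) • e₂ + t • w)) =
      (r / √2) ^ 2 * triple e₁ e₂ w := by
    change triple _ _ _ = _
    simp only [triple_eq, PiLp.add_apply, PiLp.smul_apply, smul_eq_mul]
    ring
  have h3 : triple e₁ e₂ w ^ 2 = 1 := by
    rw [triple_sq, h12, h1w, h2w, real_inner_self_eq_norm_sq, real_inner_self_eq_norm_sq,
      real_inner_self_eq_norm_sq, h1, h2, hw]
    norm_num
  have h4 : |triple e₁ e₂ w| = 1 := by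
    rw [← sq_abs] at h3
    exact (pow_eq_one_iff_of_nonneg (abs_nonneg _) two_ne_zero).1 h3
  rw [e, abs_mul, h4, mul_one, hsq, abs_of_pos (by positivity)]

/-- If the frontier is flat near `x₀`, the caps persist at larger radii. -/
lemma HasCaps.exists_forall_hasCaps {U : Set E3} (hU : IsOpen U) {x₀ w n : E3} {d : ℝ}
    (hd : 0 < d) (hw : ‖w‖ = 1) (h : HasCaps U x₀ d w) (hn : inner ℝ w n = d ^ 2 / 2)
    (hflat : ∀ x : E3, x₀ + x ∈ frontier U → ‖x‖ ≤ 7 / 5 * d → |inner ℝ x n| < d ^ 3 / 8) :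
    ∃ w' : E3, ‖w'‖ = 1 ∧ ∀ r, d ≤ r → r ≤ 7 / 5 * d → HasCaps U x₀ r w' := by
  have hnn : d ^ 2 / 2 ≤ ‖n‖ := by
    have := real_inner_le_norm w n
    rwa [hn, hw, one_mul] at this
  have hn0 : 0 < ‖n‖ := lt_of_lt_of_le (by positivity) hnn
  have hd3 : 0 < d ^ 3 := by positivity
  set K : Set E3 := Metric.closedBall 0 (7 / 5 * d) ∩ {y | d ^ 3 / 8 ≤ inner ℝ y n} with hK
  have hKconv : Convex ℝ K := (convex_closedBall _ _).inter
    (convex_halfSpace_ge ⟨fun x y => inner_add_left x y n,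
      fun c x => by rw [inner_smul_left]; rfl⟩ _)
  have hdw : d • w ∈ K := by
    refine ⟨?_, ?_⟩
    · rw [mem_closedBall_zero_iff, norm_smul, hw, Real.norm_of_nonneg hd.le]; linarith
    · rw [Set.mem_ofPred_eq, inner_smul_left, hn, conj_trivial]; nlinarith
  -- The cap centres `± d • w` decide on which side of the frontier each copy of the connected set
  -- `K` lies.
  have hcap := h (d • w) (by rw [norm_smul, hw, Real.norm_of_nonneg hd.le, mul_one]) (by
    rw [inner_smul_left, real_inner_self_eq_norm_sq, hw, conj_trivial]
    have : 1 ≤ √2 := by rw [Real.one_le_sqrt]; norm_num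
    nlinarith)
  have hplus : (fun y => x₀ + y) '' K ⊆ U := by
    refine (subset_or_subset_of_disjoint_frontier hU
      (hKconv.isPreconnected.image _ (by fun_prop)) ?_).resolve_right
      fun hsub => hsub ⟨_, hdw, rfl⟩ hcap.1
    rw [Set.disjoint_left]
    rintro _ ⟨y, ⟨hy, hy'⟩, rfl⟩ hf
    have := hflat y hf (by simpa using hy)
    exact absurd (hy'.trans (le_abs_self _)) this.not_ge
  have hminus : (fun y => x₀ - y) '' K ⊆ (closure U)ᶜ := by
    refine (subset_or_subset_of_disjoint_frontier hU
      (hKconv.isPreconnected.image _ (by fun_prop)) ?_).resolve_left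
      fun hsub => hcap.2 (hsub ⟨_, hdw, rfl⟩)
    rw [Set.disjoint_left]
    rintro _ ⟨y, ⟨hy, hy'⟩, rfl⟩ hf
    have := hflat (-y) (by rwa [← sub_eq_add_neg]) (by simpa using hy)
    rw [inner_neg_left, abs_neg] at this
    exact absurd (hy'.trans (le_abs_self _)) this.not_ge
  refine ⟨‖n‖⁻¹ • n, by rw [norm_smul, norm_inv, norm_norm, inv_mul_cancel₀ hn0.ne'],
    fun r hdr hr y hy hyw => ?_⟩
  -- In the new cap `y · n ≥ r ‖n‖ / √2 ≥ d³ / (2 √2)`, which exceeds `d³ / 8`.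
  have hyK : y ∈ K := by
    refine ⟨by rw [mem_closedBall_zero_iff, hy]; exact hr, ?_⟩
    rw [inner_smul_right] at hyw
    have h2 : √2 ≤ 2 := Real.sqrt_le_iff.2 ⟨by norm_num, by norm_num⟩
    have h20 : 0 < √2 := by positivity
    have hs : r * ‖n‖ ≤ √2 * inner ℝ y n := by
      calc r * ‖n‖ ≤ (√2 * (‖n‖⁻¹ * inner ℝ y n)) * ‖n‖ := by gcongr
        _ = _ := by field_simp
    have h3 : d * (d ^ 2 / 2) ≤ √2 * inner ℝ y n :=
      le_trans (mul_le_mul hdr hnn (by positivity) (hd.le.trans hdr)) hs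
    have h4 : 0 ≤ inner ℝ y n := by
      by_contra hneg
      nlinarith
    rw [Set.mem_ofPred_eq]
    nlinarith
  exact ⟨subset_closure (hplus ⟨y, hyK, rfl⟩), fun hmem =>
    hminus ⟨y, hyK, rfl⟩ (subset_closure hmem)⟩

/-- Strict double cones at `x₀` give caps, also at slightly larger radii. -/
lemma exists_hasCaps_of_cones {U : Set E3} (hU : IsOpen U) {x₀ v : E3} {δ : ℝ}
    (hδ : 0 < δ)
    (hin : ∀ y ∈ Metric.closedBall x₀ δ, y - x₀ ∈ coneHalf (Real.pi / 4) v → y ∈ U ∪ {x₀})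
    (hout : ∀ y ∈ Metric.closedBall x₀ δ, y - x₀ ∈ coneHalf (Real.pi / 4) (-v) →
      y ∈ (closure U)ᶜ ∪ {x₀}) :
    ∃ δ' > δ, ∀ r, 0 < r → r ≤ δ' → HasCaps U x₀ r v := by
  have hs2 : √2 * √2 = 2 := Real.mul_self_sqrt (by norm_num)
  have h20 : 0 < √2 := by positivity
  have hstrict : ∀ y : E3, 0 < ‖y‖ → ‖y‖ ≤ δ → ‖y‖ ≤ √2 * inner ℝ y v →
      x₀ + y ∈ U ∧ x₀ - y ∈ (closure U)ᶜ := by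
    intro y hy hyδ hyv
    have hcone : ‖y‖ * (√2 / 2) ≤ inner ℝ y v := by nlinarith
    have hy0 : y ≠ 0 := norm_pos_iff.1 hy
    constructor
    · refine (hin (x₀ + y) ?_ ?_).resolve_right fun h => hy0 (by simpa using h)
      · rwa [mem_closedBall_iff_norm, add_sub_cancel_left]
      · rw [coneHalf, Set.mem_ofPred_eq, add_sub_cancel_left, Real.cos_pi_div_four]
        exact hcone
    · refine (hout (x₀ - y) ?_ ?_).resolve_right fun h => hy0 (by simpa using h)
      · rwa [mem_closedBall_iff_norm, sub_sub_cancel_left, norm_neg]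
      · rw [coneHalf, Set.mem_ofPred_eq, sub_sub_cancel_left, norm_neg, inner_neg_neg,
          Real.cos_pi_div_four]
        exact hcone
  set C : Set E3 := Metric.sphere 0 δ ∩ {y | δ ≤ √2 * inner ℝ y v} with hC
  have hCc : IsCompact C := (isCompact_sphere _ _).inter_right
    (isClosed_le continuous_const (by fun_prop))
  -- Compactness of the cap makes the open conditions persist uniformly under dilation. The gain
  -- beyond `δ` gives the strict inequality required of stopping distances.
  have hev : ∀ᶠ t : ℝ in 𝓝 1, ∀ y ∈ C, x₀ + t • y ∈ U ∧ x₀ - t • y ∈ (closure U)ᶜ := by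
    refine hCc.eventually_forall_of_forall_eventually fun y hy => ?_
    have hyn : ‖y‖ = δ := by simpa using hy.1
    have hys := hstrict y (by rw [hyn]; exact hδ) hyn.le (by rw [hyn]; exact hy.2)
    have c1 : Continuous fun z : ℝ × E3 => x₀ + z.1 • z.2 := by fun_prop
    have c2 : Continuous fun z : ℝ × E3 => x₀ - z.1 • z.2 := by fun_prop
    exact (c1.continuousAt.eventually_mem (hU.mem_nhds (by simpa using hys.1))).and
      (c2.continuousAt.eventually_mem (isClosed_closure.isOpen_compl.mem_nhds
        (by simpa using hys.2)))
  obtain ⟨ε, hε, hball⟩ := Metric.eventually_nhds_iff.1 hev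
  refine ⟨δ * (1 + ε / 2), by nlinarith, fun r hr hrδ y hy hyv => ?_⟩
  rcases le_total r δ with hle | hle
  · have := hstrict y (by rw [hy]; exact hr) (by rw [hy]; exact hle) (by rw [hy]; exact hyv)
    exact ⟨subset_closure this.1, fun h => this.2 (subset_closure h)⟩
  · have h1 : dist (r / δ) 1 < ε := by
      have h2 : 1 ≤ r / δ := (one_le_div hδ).2 hle
      have h3 : r / δ ≤ 1 + ε / 2 := by rw [div_le_iff₀ hδ]; linarith
      rw [Real.dist_eq, abs_of_nonneg (by linarith)]
      linarith
    have h2 := hball h1 ((δ / r) • y) ⟨?_, ?_⟩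
    · rw [smul_smul, div_mul_div_cancel₀ hδ.ne', div_self hr.ne', one_smul] at h2
      exact ⟨subset_closure h2.1, fun h => h2.2 (subset_closure h)⟩
    · rw [mem_sphere_zero_iff_norm, norm_smul, hy, Real.norm_of_nonneg (by positivity)]
      field_simp
    · rw [Set.mem_ofPred_eq, inner_smul_left, conj_trivial]
      calc δ = δ / r * r := by field_simp
        _ ≤ δ / r * (√2 * inner ℝ y v) := by gcongr
        _ = _ := by ring

/-- The admissible radii are bounded by the diameter, and their supremum is attained by the limit
argument. -/
lemma exists_maximal_hasCaps {U : Set E3} (hU : IsOpen U) (hUb : Bornology.IsBounded U) {x₀ : E3}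
    (hx₀ : x₀ ∈ frontier U) {δ : ℝ}
    (h : ∀ r, 0 < r → r ≤ δ → ∃ w : E3, ‖w‖ = 1 ∧ HasCaps U x₀ r w) :
    ∃ d, δ ≤ d ∧ (∀ r, 0 < r → r ≤ d → ∃ w : E3, ‖w‖ = 1 ∧ HasCaps U x₀ r w) ∧
      ∀ d' > d, ∃ r, d ≤ r ∧ r ≤ d' ∧ ∀ w : E3, ‖w‖ = 1 → ¬ HasCaps U x₀ r w := by
  set G : Set ℝ := {s | ∀ r, 0 < r → r ≤ s → ∃ w : E3, ‖w‖ = 1 ∧ HasCaps U x₀ r w} with hG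
  have hbdd : BddAbove G := by
    refine ⟨Metric.diam (frontier U), fun s hs => ?_⟩
    rcases le_or_gt s 0 with h0 | h0
    · exact h0.trans Metric.diam_nonneg
    · obtain ⟨w, hw, hc⟩ := hs s h0 le_rfl
      exact hc.le_diam hU hUb hx₀ h0 hw
  have hδG : δ ∈ G := h
  have hδd : δ ≤ sSup G := le_csSup hbdd hδG
  have hlt : ∀ r, 0 < r → r < sSup G → ∃ w : E3, ‖w‖ = 1 ∧ HasCaps U x₀ r w := by
    intro r hr hrd
    obtain ⟨s, hs, hrs⟩ := exists_lt_of_lt_csSup ⟨δ, hδG⟩ hrd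
    exact hs r hr hrs.le
  have hle : sSup G ∈ G := by
    intro r hr hrd
    rcases hrd.lt_or_eq with h1 | rfl
    · exact hlt r hr h1
    · exact exists_hasCaps_of_forall_lt hU hr hlt
  refine ⟨sSup G, hδd, hle, fun d' hd' => ?_⟩
  by_contra! hcon
  refine hd'.not_ge (le_csSup hbdd fun r hr hrd => ?_)
  rcases le_total r (sSup G) with h1 | h1
  · exact hle r hr h1
  · exact hcon r h1 hrd

lemma IsAdmissibleSurface.exists_isStoppingDistance {S U Sstar : Set E3} {v : E3 → E3}
    {δ₀ : E3 → ℝ} (hS : IsAdmissibleSurface S U Sstar v δ₀) {x₀ : E3} (hx₀ : x₀ ∈ Sstar) :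
    ∃ d, IsStoppingDistance (1 / 100000) (1 / 1000) S (δ₀ x₀) x₀ d := by
  have hU := hS.isOpen_domain
  have hUb := hS.isBounded_domain
  obtain rfl := hS.eq_frontier
  have hxf := hS.subset hx₀
  have hδ := hS.radius_pos x₀ hx₀
  obtain ⟨δ', hδ', hcaps⟩ := exists_hasCaps_of_cones hU hδ (hS.cone_inside x₀ hx₀)
    (hS.cone_outside x₀ hx₀)
  obtain ⟨d, hδd, hd, hmax⟩ := exists_maximal_hasCaps hU hUb hxf
    fun r hr hrδ => ⟨v x₀, hS.norm_axis x₀ hx₀, hcaps r hr hrδ⟩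
  have hd0 : 0 < d := hδ.trans (hδ'.trans_le hδd)
  obtain ⟨w, hw, hc⟩ := hd d hd0 le_rfl
  refine ⟨d, hδ'.trans_le hδd, hc.le_diam hU hUb hxf hd0 hw, ?_, fun r hr hrd => ?_,
    fun r hr hrd => ?_⟩
  · obtain ⟨a, b, ha, hb, har, hbr, hab⟩ := hc.exists_cross hU hd0 hw
    obtain ⟨c, hcf, hcr, hdet⟩ : ∃ c : E3, x₀ + c ∈ frontier U ∧ ‖c‖ ≤ 7 / 5 * d ∧
        d ^ 3 / 8 ≤ |inner ℝ c (cross a b)| := by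
      by_contra! hflat
      obtain ⟨w', hw', hr'⟩ : ∃ w' : E3, ‖w'‖ = 1 ∧
          ∀ r, d ≤ r → r ≤ 7 / 5 * d → HasCaps U x₀ r w' := by
        -- The normal is oriented so that its component along `w` is positive.
        rcases abs_choice (inner ℝ w (cross a b) : ℝ) with h1 | h1
        · exact hc.exists_forall_hasCaps hU hd0 hw (h1.symm.trans hab) hflat
        · refine hc.exists_forall_hasCaps hU hd0 hw (n := -cross a b) ?_ fun x hx hxr => ?_
          · rw [inner_neg_right, ← h1, hab]
          · rw [inner_neg_right, abs_neg]; exact hflat x hx hxr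
      obtain ⟨r, h1, h2, h3⟩ := hmax (7 / 5 * d) (by linarith)
      exact h3 w' hw' (hr' r h1 h2)
    refine ⟨_, ha, _, hb, _, hcf, isVoluminous_of_fat hd0 (fun i => ?_) ?_⟩
    · fin_cases i
      · simp [hd0.le]
      · simpa using har.trans (by linarith)
      · simpa using hbr.trans (by linarith)
      · simpa using hcr
    · simpa [tetDet, triple] using hdet
  · obtain ⟨w', hw', hc'⟩ := hd r hr hrd
    exact ⟨_, finrank_orthogonal_unit hw', hc'.large_projection hU hr hw'⟩
  · obtain ⟨w', hw', hc'⟩ := hd r hr hrd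
    exact hc'.lower_area hU hr hw'

/-! ### Energy and stopping distances -/

lemma IsStoppingDistance.mengerEnergy_ge {α η δ d p β : ℝ} {S : Set E3} {x₀ : E3}
    (h : IsStoppingDistance α η S δ x₀ d) (hp : 0 ≤ p) (hη : 0 < η) (hd : 0 < d)
    (hβ : 0 ≤ β) (hS : IsCompact S) (hx₀ : x₀ ∈ S)
    (hβS : ∀ x ∈ S, ENNReal.ofReal (β * d ^ 2) ≤ H2 (S ∩ Metric.closedBall x (α * d))) :
    ENNReal.ofReal ((η ^ 4 / 147456) ^ p * β ^ 4 * d ^ (8 - p)) ≤ mengerEnergy p S := by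
  obtain ⟨x₁, h₁, x₂, h₂, x₃, h₃, -, hT⟩ := h.good_tetrahedron
  refine mengerEnergy_ge_of_tetrahedron hp hη hd hβ hS hT fun i => ?_
  fin_cases i
  exacts [hβS x₀ hx₀, hβS x₁ h₁, hβS x₂ h₂, hβS x₃ h₃]

lemma le_of_ofReal_mul_rpow_le {C d p : ℝ} {M : ℝ≥0∞} (hC : 0 < C) (hd : 0 < d) (hp : 8 < p)
    (hM : M < ⊤) (h : ENNReal.ofReal (C * d ^ (8 - p)) ≤ M) :
    0 < M.toReal ∧ (C / M.toReal) ^ (1 / (p - 8)) ≤ d := by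
  have h1 := (ENNReal.ofReal_le_iff_le_toReal hM.ne).1 h
  have h2 : 0 < d ^ (8 - p) := Real.rpow_pos_of_pos hd _
  have hM0 : 0 < M.toReal := lt_of_lt_of_le (by positivity) h1
  refine ⟨hM0, ?_⟩
  have h3 : C / M.toReal ≤ d ^ (p - 8) := by
    rw [← neg_sub 8 p, Real.rpow_neg hd.le, div_le_iff₀ hM0, ← div_eq_inv_mul, le_div_iff₀ h2]
    exact h1
  calc (C / M.toReal) ^ (1 / (p - 8)) ≤ (d ^ (p - 8)) ^ (1 / (p - 8)) :=
        Real.rpow_le_rpow (by positivity) h3 (one_div_nonneg.2 (by linarith))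
    _ = d := by rw [one_div, Real.rpow_rpow_inv hd.le (by linarith)]

/-- Every factor is bounded below by a `p`-th power: `(α² / 16)⁴ = (α / 4)⁸ ≥ (α / 4) ^ p` since `p
> 8` and `α / 4 < 1`, and replacing `d ≤ 2 m` by `m` costs at most `2 ^ (-p)`. What remains is a
numerical comparison with `α⁵`. -/
lemma rpow_mul_le_energy_constant {m d p : ℝ} (hm : 0 < m) (hmd : m ≤ d) (hdm : d ≤ 2 * m)
    (hp : 8 < p) :
    ((1 / 100000 : ℝ)) ^ (5 * p) * m ^ (8 - p) ≤
      ((1 / 1000 : ℝ) ^ 4 / 147456) ^ p * ((1 / 100000 : ℝ) ^ 2 / 16) ^ 4 * d ^ (8 - p) := by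
  have hd : 0 < d := hm.trans_le hmd
  have h1 : (1 / 2 : ℝ) ^ p * m ^ (8 - p) ≤ d ^ (8 - p) := by
    have h2 : (2 * m) ^ (8 - p) ≤ d ^ (8 - p) :=
      Real.rpow_le_rpow_of_nonpos hd hdm (by linarith)
    refine le_trans ?_ h2
    rw [Real.mul_rpow two_pos.le hm.le]
    have h3 : (1 / 2 : ℝ) ^ p ≤ 2 ^ (8 - p) := by
      rw [one_div, Real.inv_rpow two_pos.le, ← Real.rpow_neg two_pos.le]
      exact Real.rpow_le_rpow_of_exponent_le one_le_two (by linarith)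
    gcongr
  have h2 : (1 / 400000 : ℝ) ^ p ≤ ((1 / 100000 : ℝ) ^ 2 / 16) ^ 4 := by
    have e : ((1 / 100000 : ℝ) ^ 2 / 16) ^ 4 = (1 / 400000 : ℝ) ^ (8 : ℝ) := by
      rw [show (8 : ℝ) = ((8 : ℕ) : ℝ) by norm_num, Real.rpow_natCast]; norm_num
    rw [e]
    exact Real.rpow_le_rpow_of_exponent_ge (by norm_num) (by norm_num) hp.le
  have h3 : (1 / 100000 : ℝ) ^ (5 * p) ≤
      ((1 / 1000 : ℝ) ^ 4 / 147456) ^ p * (1 / 400000 : ℝ) ^ p * (1 / 2 : ℝ) ^ p := by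
    rw [← Real.mul_rpow (by norm_num) (by norm_num), ← Real.mul_rpow (by norm_num) (by norm_num),
      Real.rpow_mul (by norm_num)]
    refine Real.rpow_le_rpow (by positivity) ?_ (by linarith)
    rw [show (5 : ℝ) = ((5 : ℕ) : ℝ) by norm_num, Real.rpow_natCast]
    norm_num
  calc (1 / 100000 : ℝ) ^ (5 * p) * m ^ (8 - p)
      ≤ ((1 / 1000 : ℝ) ^ 4 / 147456) ^ p * (1 / 400000 : ℝ) ^ p * (1 / 2 : ℝ) ^ p *
          m ^ (8 - p) := by gcongr
    _ = ((1 / 1000 : ℝ) ^ 4 / 147456) ^ p * (1 / 400000 : ℝ) ^ p *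
          ((1 / 2 : ℝ) ^ p * m ^ (8 - p)) := by ring
    _ ≤ _ := by gcongr

/-- Stopping distances on a surface of finite energy are bounded away from zero. -/
lemma IsAdmissibleSurface.exists_pos_le_stoppingDistance {S U Sstar : Set E3} {v : E3 → E3}
    {δ₀ ds : E3 → ℝ} (hS : IsAdmissibleSurface S U Sstar v δ₀)
    {α η p : ℝ} (hα : 0 < α) (hα1 : α ≤ 1) (hη : 0 < η)
    (hds : ∀ x₀ ∈ Sstar, IsStoppingDistance α η S (δ₀ x₀) x₀ (ds x₀)) (hp : 8 < p)
    (hfin : mengerEnergy p S < ⊤) : ∃ ε > 0, ∀ x₀ ∈ Sstar, ε ≤ ds x₀ := by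
  obtain ⟨K, hK, harea⟩ := hS.area_bound
  have hC : 0 < (η ^ 4 / 147456) ^ p * (K⁻¹ * α ^ 2) ^ 4 := by positivity
  have key : ∀ x₀ ∈ Sstar, 0 < (mengerEnergy p S).toReal ∧
      ((η ^ 4 / 147456) ^ p * (K⁻¹ * α ^ 2) ^ 4 / (mengerEnergy p S).toReal) ^ (1 / (p - 8)) ≤
        ds x₀ := by
    intro x₀ hx₀
    have hd : 0 < ds x₀ := (hS.radius_pos x₀ hx₀).trans (hds x₀ hx₀).radius_lt
    refine le_of_ofReal_mul_rpow_le hC hd hp hfin ?_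
    refine (hds x₀ hx₀).mengerEnergy_ge (by linarith) hη hd (by positivity) hS.isCompact
      (hS.subset hx₀) fun x hx => ?_
    have h1 := (harea x hx (α * ds x₀) (by positivity)
      ((mul_le_of_le_one_left hd.le hα1).trans (hds x₀ hx₀).le_diam)).2
    convert h1 using 2
    ring
  rcases Sstar.eq_empty_or_nonempty with rfl | ⟨x, hx⟩
  · exact ⟨1, one_pos, by simp⟩
  · have hM := (key x hx).1
    exact ⟨_, by positivity, fun x₀ hx₀ => (key x₀ hx₀).2⟩

/-- If all stopping distances exceed `m`, the surface has large area in all balls of comparable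
radius. -/
lemma IsAdmissibleSurface.area_ge_of_le_stoppingDistance {S U Sstar : Set E3} {v : E3 → E3}
    {δ₀ ds : E3 → ℝ} (hS : IsAdmissibleSurface S U Sstar v δ₀) {α η m ρ : ℝ}
    (hds : ∀ x₀ ∈ Sstar, IsStoppingDistance α η S (δ₀ x₀) x₀ (ds x₀))
    (hm : ∀ x₀ ∈ Sstar, m ≤ ds x₀) (hρ : 0 < ρ) (hρm : ρ / 4 ≤ m) {x : E3} (hx : x ∈ S) :
    ENNReal.ofReal ((ρ / 4) ^ 2) ≤ H2 (S ∩ Metric.closedBall x ρ) := by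
  -- The ball of radius `ρ / 4` about `y` lies in that of radius `ρ` about `x`, and `ρ / 4` is
  -- within the range of the area bound at `y`.
  obtain ⟨y, hy, hxy⟩ := Metric.mem_closure_iff.1 (hS.dense hx) (ρ / 4) (by positivity)
  have h1 := (hds y hy).lower_area (ρ / 4) (by positivity) (hρm.trans (hm y hy))
  refine (ENNReal.ofReal_le_ofReal ?_).trans (h1.trans (measure_mono ?_))
  · have : 1 ≤ Real.pi / 2 := by linarith [Real.two_le_pi]
    nlinarith [sq_nonneg (ρ / 4)]
  · refine Set.inter_subset_inter_right _ (Metric.closedBall_subset_closedBall' ?_)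
    rw [dist_comm] at hxy
    linarith

end IntegralMenger

theorem proposition3p5 :
    ∃ α η : ℝ, 0 < 40 * α ∧ 40 * α < 2 * η ∧ 2 * η < 1 ∧
      ∀ (S U Sstar : Set IntegralMenger.E3) (v : IntegralMenger.E3 → IntegralMenger.E3)
        (δ₀ : IntegralMenger.E3 → ℝ),
        IntegralMenger.IsAdmissibleSurface S U Sstar v δ₀ →
        (∃ ds : IntegralMenger.E3 → ℝ,
          ∀ x₀ ∈ Sstar, IntegralMenger.IsStoppingDistance α η S (δ₀ x₀) x₀ (ds x₀)) ∧
        ∀ ds : IntegralMenger.E3 → ℝ,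
          (∀ x₀ ∈ Sstar, IntegralMenger.IsStoppingDistance α η S (δ₀ x₀) x₀ (ds x₀)) →
          ∀ p : ℝ, 8 < p → IntegralMenger.mengerEnergy p S < ⊤ →
            ∃ d : ℝ, IsGLB (ds '' Sstar) d ∧ 0 < d ∧
              ENNReal.ofReal (α ^ (5 * p) * d ^ (8 - p)) ≤ IntegralMenger.mengerEnergy p S ∧
              0 < IntegralMenger.mengerEnergy p S ∧
              (α ^ (5 * p) / (IntegralMenger.mengerEnergy p S).toReal) ^ (1 / (p - 8)) ≤ d ∧
              d ≤ Metric.diam S := by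
  refine ⟨1 / 100000, 1 / 1000, by norm_num, by norm_num, by norm_num, fun S U Sstar v δ₀ hS => ?_⟩
  constructor
  · choose! ds hds using fun x₀ (hx₀ : x₀ ∈ Sstar) => hS.exists_isStoppingDistance hx₀
    exact ⟨ds, hds⟩
  intro ds hds p hp hfin
  obtain ⟨ε, hε, hεds⟩ := hS.exists_pos_le_stoppingDistance (by norm_num) (by norm_num)
    (by norm_num) hds hp hfin
  have hne : (ds '' Sstar).Nonempty := by
    obtain ⟨x, hx⟩ := hS.isConnected.nonempty
    exact (closure_nonempty_iff.1 ⟨x, hS.dense hx⟩).image ds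
  have hbdd : BddBelow (ds '' Sstar) := ⟨ε, by rintro _ ⟨x, hx, rfl⟩; exact hεds x hx⟩
  have hm : 0 < sInf (ds '' Sstar) :=
    hε.trans_le (le_csInf hne (by rintro _ ⟨x, hx, rfl⟩; exact hεds x hx))
  have hle : ∀ x ∈ Sstar, sInf (ds '' Sstar) ≤ ds x := fun x hx => csInf_le hbdd ⟨x, hx, rfl⟩
  -- The infimum need not be attained; a factor 2 is absorbed by the constant.
  obtain ⟨_, ⟨x₀, hx₀, rfl⟩, hlt⟩ := exists_lt_of_csInf_lt hne
    (show sInf (ds '' Sstar) < 2 * sInf (ds '' Sstar) by linarith)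
  generalize hmdef : sInf (ds '' Sstar) = m at hm hle hlt
  have hd : 0 < ds x₀ := hm.trans_le (hle x₀ hx₀)
  have hE : ENNReal.ofReal ((1 / 100000 : ℝ) ^ (5 * p) * m ^ (8 - p)) ≤
      IntegralMenger.mengerEnergy p S := by
    refine (ENNReal.ofReal_le_ofReal (IntegralMenger.rpow_mul_le_energy_constant hm (hle x₀ hx₀)
      hlt.le hp)).trans ?_
    -- Here `β = α² / 16`, from the area `(ρ / 4)²` with `ρ = α * ds x₀`.
    refine (hds x₀ hx₀).mengerEnergy_ge (by linarith) (by norm_num) hd (by norm_num) hS.isCompact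
      (hS.subset hx₀) fun x hx => ?_
    refine le_trans (le_of_eq ?_) (hS.area_ge_of_le_stoppingDistance hds hle
      (ρ := 1 / 100000 * ds x₀) (by positivity) (by linarith) hx)
    congr 1; ring
  obtain ⟨hM, hlow⟩ := IntegralMenger.le_of_ofReal_mul_rpow_le
    (Real.rpow_pos_of_pos (by norm_num : (0 : ℝ) < 1 / 100000) (5 * p)) hm hp hfin hE
  exact ⟨m, hmdef ▸ isGLB_csInf hne hbdd, hm, hE, (ENNReal.toReal_pos_iff.1 hM).1, hlow,
    (hle x₀ hx₀).trans (hds x₀ hx₀).le_diam⟩
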